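/- Let $M$ be a matroid on a finite ground set $E$ without loops and coloops, and let $B(M)\subseteq\mathbb R^E$ be its base polytope, i.e. the convex hull of the characteristic vectors of the bases of $M$. Let $v_1,\dots,v_n$ be the vertices of $B(M)$, each listed once, and let $Ax\le b$ (with $A\in\mathbb R^{m\times E}$, $b\in\mathbb R^m$) be a system of inequalities that describes $B(M)$ within its affine hull, i.e. $B(M)=\{x\in\mathrm{aff}(B(M)) \mid Ax\le b\}$. Let $S\in\mathbb R^{m\times n}$ be the corresponding slack matrix of $B(M)$, $S_{i,j}:=b_i-A_iv_j$. Assume that no row of $S$ is constant, and that each inequality $A_ix\le b_i$ is facet-defining for $B(M)$ or $2$-level (there is $b_i'<b_i$ such that $A_iv_j\in\{b_i,b_i'\}$ for all $j$). This holds in particular if $S$ is a non-redundant slack matrix (its rows correspond bijectively to the facets), and also if $S$ is a $0/1$ matrix without constant rows. Then $M$ is connected if and only if $S$ is irreducible. Here $M$ is connected if it is not the direct sum ($1$-sum) of two matroids on disjoint non-empty ground sets. For $S_1\in\mathbb R^{m_1\times n_1}$ and $S_2\in\mathbb R^{m_2\times n_2}$, $S_1\otimes S_2\in\mathbb R^{(m_1+m_2)\times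 n_1n_2}$ is the matrix whose columns are all the concatenations $\binom{c}{d}$ of a column $c$ of $S_1$ with a column $d$ of $S_2$ (one for each pair of column indices). A matrix is a $1$-product if, up to permuting rows and columns, it equals $S_1\otimes S_2$ for some matrices $S_1,S_2$ each having at least one row and one column; it is irreducible if it is not a $1$-product. -/

import Mathlib

open Matrix

/-- The 1-product `S₁ ⊗ S₂`: its columns are all the concatenations of a column of `S₁`
with a column of `S₂`. -/
def Matrix.oneProd {I₁ J₁ I₂ J₂ : Type*} (S₁ : Matrix I₁ J₁ ℝ) (S₂ : Matrix I₂ J₂ ℝ) :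
    Matrix (I₁ ⊕ I₂) (J₁ × J₂) ℝ :=
  Matrix.of fun i j => Sum.elim (fun i₁ => S₁ i₁ j.1) (fun i₂ => S₂ i₂ j.2) i

/-- Two matrices are isomorphic if they agree up to permuting rows and columns. -/
def Matrix.Isomorphic {I J I' J' : Type*} (S : Matrix I J ℝ) (T : Matrix I' J' ℝ) : Prop :=
  ∃ (e : I ≃ I') (f : J ≃ J'), ∀ i j, S i j = T (e i) (f j)

/-- `S` is a 1-product: it is isomorphic to `S₁ ⊗ S₂` for two non-empty matrices `S₁`, `S₂`
(non-empty: at least one row and at least one column). -/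
def Matrix.IsOneProduct {I J : Type*} (S : Matrix I J ℝ) : Prop :=
  ∃ (m₁ n₁ m₂ n₂ : ℕ) (S₁ : Matrix (Fin m₁) (Fin n₁) ℝ) (S₂ : Matrix (Fin m₂) (Fin n₂) ℝ),
    0 < m₁ ∧ 0 < n₁ ∧ 0 < m₂ ∧ 0 < n₂ ∧ S.Isomorphic (S₁.oneProd S₂)

/-- A matrix is irreducible if it is not a 1-product. This is unrelated to
`Matrix.IsIrreducible`, the Perron-Frobenius notion. -/
def Matrix.OneProdIrreducible {I J : Type*} (S : Matrix I J ℝ) : Prop :=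
  ¬ S.IsOneProduct

/-- The matrix of the slacks of the points `v j` with respect to the inequalities
`(A x) i ≤ b i`. -/
def slackMatrix {I J D : Type*} [Fintype D] (A : Matrix I D ℝ) (b : I → ℝ) (v : J → D → ℝ) :
    Matrix I J ℝ :=
  Matrix.of fun i j => b i - (A *ᵥ v j) i

/-- `A x ≤ b` describes `P` inside the affine hull of `P` (the equations of the affine hull are
not part of the system, as they would only contribute zero rows to a slack matrix). -/
def IsInequalityDescription {I D : Type*} [Fintype D] (P : Set (D → ℝ)) (A : Matrix I D ℝ)
    (b : I → ℝ) : Prop :=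
  P = {x | x ∈ affineSpan ℝ P ∧ ∀ i, (A *ᵥ x) i ≤ b i}

/-- `v` lists the vertices of the polytope `P`, each exactly once. -/
def IsVertexList {J D : Type*} (P : Set (D → ℝ)) (v : J → D → ℝ) : Prop :=
  P = convexHull ℝ (Set.range v) ∧ Function.Injective v ∧ Set.range v = P.extremePoints ℝ

/-- `F` is a facet of `P`: a non-empty face of dimension `dim P - 1`. -/
def IsFacet {D : Type*} (P F : Set (D → ℝ)) : Prop :=
  IsExposed ℝ P F ∧ F.Nonempty ∧
    Module.finrank ℝ (vectorSpan ℝ F) + 1 = Module.finrank ℝ (vectorSpan ℝ P)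

/-- The inequality `a ⬝ x ≤ β` is facet-defining for `P`. -/
def IsFacetDefining {D : Type*} [Fintype D] (P : Set (D → ℝ)) (a : D → ℝ) (β : ℝ) : Prop :=
  (∀ x ∈ P, a ⬝ᵥ x ≤ β) ∧ IsFacet P {x | x ∈ P ∧ a ⬝ᵥ x = β}

/-- The inequality `a ⬝ x ≤ β` is 2-level with respect to `P`. -/
def IsTwoLevel {D : Type*} [Fintype D] (P : Set (D → ℝ)) (a : D → ℝ) (β : ℝ) : Prop :=
  ∃ β' < β, ∀ x ∈ P.extremePoints ℝ, a ⬝ᵥ x = β ∨ a ⬝ᵥ x = β'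

/-- The base polytope: the convex hull of the characteristic vectors of the bases, in the
space of real vectors indexed by the ground set. -/
def Matroid.basePolytope {α : Type*} (M : Matroid α) : Set (M.E → ℝ) :=
  convexHull ℝ {x | ∃ B, M.IsBase B ∧ x = fun e : M.E => B.indicator (fun _ => (1 : ℝ)) (e : α)}

/-- `M` is connected: it is not the 1-sum (direct sum) of two matroids with disjoint non-empty
ground sets (each of which then has fewer elements than `M`). -/
def Matroid.IsConnectedMatroid {α : Type*} (M : Matroid α) : Prop :=
  ¬ ∃ (M₁ M₂ : Matroid α) (h : Disjoint M₁.E M₂.E),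
    M₁.E.Nonempty ∧ M₂.E.Nonempty ∧ M = M₁.disjointSum M₂ h

/-! Both properties say that the vertices form a grid `J₁ × J₂` whose points recombine freely. The
link is that a bounded polyhedron contains no line, so slacks determine points, and linear relations
among slack columns lift to the vertices. If the slack matrix is a 1-product, each row sees only one
index, so `u (x, y) - u (x', y)` does not depend on `y`. A coordinate of `u` is thus a sum of a
function of `x` and a function of `y`; since it takes only the values 0 and 1, one of the two is
constant. This partitions the ground set into two parts along which bases recombine, and
`Matroid.eq_disjointSum_of_isBase_union` gives a direct sum. Absence of constant rows makes both
parts non-empty. Conversely, the bases of a direct sum are the pairs of bases, and each row of `A`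
splits as `a₁ + a₂` by support. If neither summand were constant on the vertices, the face cut out
by the row would maximise both, hence have codimension at least 2, and the row would take more than
two values (`const_of_isFacetDefining_or_isTwoLevel`). So each row depends on one factor only.
Without loops and coloops each factor has two bases, and separating them requires rows of both
kinds. -/

/-- The characteristic vector of a set, restricted to the ground set of a matroid. -/
noncomputable def Matroid.charVec {α : Type*} (M : Matroid α) (B : Set α) : M.E → ℝ :=
  fun e => B.indicator (fun _ => (1 : ℝ)) (e : α)

/-! ### Vertices of base polytopes and recombination of bases -/

namespace Matroid

variable {α : Type*} {M : Matroid α}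

lemma charVec_of_mem {B : Set α} {e : M.E} (h : (e : α) ∈ B) : M.charVec B e = 1 := by
  simp [charVec, h]

lemma charVec_of_notMem {B : Set α} {e : M.E} (h : (e : α) ∉ B) : M.charVec B e = 0 := by
  simp [charVec, h]

lemma charVec_eq_zero_or_one (B : Set α) (e : M.E) :
    M.charVec B e = 0 ∨ M.charVec B e = 1 := by
  by_cases h : (e : α) ∈ B
  · exact Or.inr (charVec_of_mem h)
  · exact Or.inl (charVec_of_notMem h)

lemma charVec_eq_iff {B B' : Set α} {e : M.E} :
    M.charVec B e = M.charVec B' e ↔ ((e : α) ∈ B ↔ (e : α) ∈ B') := by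
  by_cases h : (e : α) ∈ B <;> by_cases h' : (e : α) ∈ B' <;> simp [charVec, h, h']

lemma charVec_injOn {B B' : Set α} (hB : B ⊆ M.E) (hB' : B' ⊆ M.E)
    (h : M.charVec B = M.charVec B') : B = B' := by
  ext e
  by_cases he : e ∈ M.E
  · exact charVec_eq_iff.1 (congrFun h ⟨e, he⟩)
  · exact iff_of_false (fun h => he (hB h)) (fun h => he (hB' h))

lemma charVec_mem_Icc (B : Set α) : M.charVec B ∈ Set.Icc (0 : M.E → ℝ) 1 := by
  constructor <;> intro e <;> rcases charVec_eq_zero_or_one B e with h | h <;> simp [h]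

lemma basePolytope_eq : M.basePolytope = convexHull ℝ {x | ∃ B, M.IsBase B ∧ x = M.charVec B} :=
  rfl

lemma charVec_mem_basePolytope {B : Set α} (hB : M.IsBase B) :
    M.charVec B ∈ M.basePolytope :=
  subset_convexHull ℝ _ ⟨B, hB, rfl⟩

lemma basePolytope_subset_Icc : M.basePolytope ⊆ Set.Icc (0 : M.E → ℝ) 1 := by
  rw [basePolytope_eq]
  refine convexHull_min ?_ (convex_Icc _ _)
  rintro _ ⟨B, -, rfl⟩
  exact charVec_mem_Icc B

/-- A 0/1 vector is a vertex of the unit cube, hence extreme in every subset of the cube that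
contains it. -/
lemma extremePoints_basePolytope :
    M.basePolytope.extremePoints ℝ = {x | ∃ B, M.IsBase B ∧ x = M.charVec B} := by
  refine Set.Subset.antisymm extremePoints_convexHull_subset ?_
  rintro _ ⟨B, hB, rfl⟩
  refine mem_extremePoints.2 ⟨charVec_mem_basePolytope hB, ?_⟩
  rintro x hx y hy ⟨s, t, hs, ht, hst, hxy⟩
  have key : ∀ e, x e = M.charVec B e ∧ y e = M.charVec B e := by
    intro e
    have h1 := congrFun hxy e
    have hx0 := (basePolytope_subset_Icc hx).1 e
    have hx1 := (basePolytope_subset_Icc hx).2 e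
    have hy0 := (basePolytope_subset_Icc hy).1 e
    have hy1 := (basePolytope_subset_Icc hy).2 e
    simp only [Pi.add_apply, Pi.smul_apply, smul_eq_mul, Pi.zero_apply, Pi.one_apply] at *
    rcases charVec_eq_zero_or_one B e with h | h <;> rw [h] at h1 ⊢
    · have a := mul_nonneg hs.le hx0
      have b := mul_nonneg ht.le hy0
      exact ⟨(mul_eq_zero.1 (by linarith : s * x e = 0)).resolve_left hs.ne',
        (mul_eq_zero.1 (by linarith : t * y e = 0)).resolve_left ht.ne'⟩
    · have a := mul_nonneg hs.le (sub_nonneg.2 hx1)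
      have b := mul_nonneg ht.le (sub_nonneg.2 hy1)
      have a' := (mul_eq_zero.1 (by linarith : s * (1 - x e) = 0)).resolve_left hs.ne'
      have b' := (mul_eq_zero.1 (by linarith : t * (1 - y e) = 0)).resolve_left ht.ne'
      constructor <;> linarith
  exact ⟨funext fun e => (key e).1, funext fun e => (key e).2⟩

/-- A matroid whose bases can be recombined freely along a partition of the ground set is the
direct sum of its restrictions to the two parts. -/
lemma eq_disjointSum_of_isBase_union {E₁ E₂ : Set α}
    (hd : Disjoint (M ↾ E₁).E (M ↾ E₂).E) (hE : E₁ ∪ E₂ = M.E)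
    (hM : ∀ B B', M.IsBase B → M.IsBase B' → M.IsBase (B ∩ E₁ ∪ B' ∩ E₂)) :
    M = (M ↾ E₁).disjointSum (M ↾ E₂) hd := by
  have aux : ∀ F₁ F₂ : Set α, F₁ ∪ F₂ = M.E → Disjoint F₁ F₂ →
      (∀ B B', M.IsBase B → M.IsBase B' → M.IsBase (B ∩ F₁ ∪ B' ∩ F₂)) →
      ∀ X, (M ↾ F₁).IsBase X ↔ ∃ B, M.IsBase B ∧ X = B ∩ F₁ := by
    intro F₁ F₂ hF hdF h X
    rw [isBase_iff_maximal_indep]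
    constructor
    · intro hX
      obtain ⟨hXi, hXF⟩ := restrict_indep_iff.1 hX.prop
      obtain ⟨B, hB, hXB⟩ := hXi.exists_isBase_superset
      refine ⟨B, hB, ?_⟩
      exact hX.eq_of_subset
        (restrict_indep_iff.2 ⟨hB.indep.inter_right _, Set.inter_subset_right⟩)
        (Set.subset_inter hXB hXF)
    · rintro ⟨B, hB, rfl⟩
      refine ⟨restrict_indep_iff.2 ⟨hB.indep.inter_right _, Set.inter_subset_right⟩, ?_⟩
      intro Y hY hBY
      obtain ⟨hYi, hYF⟩ := restrict_indep_iff.1 hY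
      obtain ⟨B', hB', hYB'⟩ := hYi.exists_isBase_superset
      -- Replacing the `F₁` part of `B` by that of `B'` gives a base containing `B`, hence equal to
      -- `B`; so `Y`, which lies in `B' ∩ F₁`, lies in `B`.
      have hsub : B ⊆ B' ∩ F₁ ∪ B ∩ F₂ := by
        intro x hx
        have hxE := hB.subset_ground hx
        rw [← hF] at hxE
        rcases hxE with h1 | h2
        · exact Or.inl ⟨hYB' (hBY ⟨hx, h1⟩), h1⟩
        · exact Or.inr ⟨hx, h2⟩
      have heq := hB.eq_of_subset_isBase (h B' B hB' hB) hsub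
      intro y hy
      refine ⟨?_, hYF hy⟩
      rw [heq]
      exact Or.inl ⟨hYB' hy, hYF hy⟩
  have h₁ := aux E₁ E₂ hE hd hM
  have h₂ := aux E₂ E₁ (by rw [Set.union_comm, hE]) hd.symm
    (fun B B' hB hB' => by rw [Set.union_comm]; exact hM B' B hB' hB)
  refine ext_isBase (disjointSum_ground_eq.trans hE).symm ?_
  intro B hBE
  rw [disjointSum_isBase_iff, h₁, h₂]
  simp only [restrict_ground_eq]
  constructor
  · intro hB
    exact ⟨⟨B, hB, rfl⟩, ⟨B, hB, rfl⟩, hE ▸ hBE⟩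
  · rintro ⟨⟨B₁, hB₁, h1⟩, ⟨B₂, hB₂, h2⟩, hB⟩
    have := hM B₁ B₂ hB₁ hB₂
    rwa [← h1, ← h2, ← Set.inter_union_distrib_left, Set.inter_eq_left.2 hB] at this

end Matroid

/-! ### Polyhedra and functionals on a product of vertices -/

/-- A bounded polyhedron has a trivial lineality space. -/
lemma IsInequalityDescription.eq_zero_of_mulVec_eq_zero {I D : Type*} [Fintype D]
    {P : Set (D → ℝ)} {A : Matrix I D ℝ} {b : I → ℝ} (hA : IsInequalityDescription P A b)
    (hP : P ⊆ Set.Icc 0 1) (hne : P.Nonempty) {w : D → ℝ} (hw : w ∈ vectorSpan ℝ P)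
    (hAw : A *ᵥ w = 0) : w = 0 := by
  obtain ⟨x, hx⟩ := hne
  have key : ∀ t : ℝ, t • w + x ∈ P := by
    intro t
    rw [hA]
    refine ⟨?_, fun i => ?_⟩
    · refine AffineSubspace.vadd_mem_of_mem_direction ?_ (subset_affineSpan ℝ P hx)
      rw [direction_affineSpan]
      exact Submodule.smul_mem _ _ hw
    · rw [Matrix.mulVec_add, Matrix.mulVec_smul, hAw, smul_zero, zero_add]
      rw [hA] at hx
      exact hx.2 i
  funext e
  by_contra hne
  -- This multiple of `w` raises coordinate `e` by 2, out of the unit cube.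
  have h1 := (hP (key (2 / w e))).2 e
  have h0 := (hP hx).1 e
  have hne' : w e ≠ 0 := hne
  simp only [Pi.add_apply, Pi.smul_apply, smul_eq_mul, Pi.one_apply, Pi.zero_apply] at h1 h0
  rw [div_mul_cancel₀ _ hne'] at h1
  linarith

/-- If a sum of two reals only takes two values, then one of the summands is constant. -/
lemma eq_or_eq_of_add_two_values {s t p q β β' : ℝ} (h₁ : s + p = β ∨ s + p = β')
    (h₂ : s + q = β ∨ s + q = β') (h₃ : t + p = β ∨ t + p = β') (h₄ : t + q = β ∨ t + q = β') :
    s = t ∨ p = q := by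
  rcases h₁ with h₁ | h₁ <;> rcases h₂ with h₂ | h₂ <;> rcases h₃ with h₃ | h₃ <;>
    rcases h₄ with h₄ | h₄ <;>
    first
    | exact Or.inl (by linarith)
    | exact Or.inr (by linarith)

/-- On a convex hull, a linear functional is bounded by its bound on the generators. -/
lemma dotProduct_le_of_mem_convexHull {J D : Type*} [Fintype D] {u : J → D → ℝ} {a : D → ℝ}
    {c : ℝ} (h : ∀ j, a ⬝ᵥ u j ≤ c) {x : D → ℝ} (hx : x ∈ convexHull ℝ (Set.range u)) :
    a ⬝ᵥ x ≤ c := by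
  have hc : Convex ℝ {x : D → ℝ | a ⬝ᵥ x ≤ c} :=
    convex_halfSpace_le (f := fun x => a ⬝ᵥ x)
      ⟨fun x y => dotProduct_add a x y, fun r x => dotProduct_smul r a x⟩ c
  exact convexHull_min (by rintro _ ⟨j, rfl⟩; exact h j) hc hx

/-- A facet-defining or 2-level functional that splits along a product structure of the vertices
is constant on one of the two factors. -/
lemma const_of_isFacetDefining_or_isTwoLevel {D J₁ J₂ : Type*} [Fintype D] [Finite J₁] [Finite J₂]
    {P : Set (D → ℝ)} {u : J₁ × J₂ → D → ℝ} (hP : P = convexHull ℝ (Set.range u))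
    (hext : Set.range u = P.extremePoints ℝ) {a₁ a₂ : D → ℝ} {β : ℝ}
    (h₁ : ∀ x y y', a₁ ⬝ᵥ u (x, y) = a₁ ⬝ᵥ u (x, y'))
    (h₂ : ∀ x x' y, a₂ ⬝ᵥ u (x, y) = a₂ ⬝ᵥ u (x', y))
    (h : IsFacetDefining P (a₁ + a₂) β ∨ IsTwoLevel P (a₁ + a₂) β) :
    (∀ j j', a₁ ⬝ᵥ u j = a₁ ⬝ᵥ u j') ∨ (∀ j j', a₂ ⬝ᵥ u j = a₂ ⬝ᵥ u j') := by
  by_contra! hcon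
  obtain ⟨⟨⟨x, y⟩, ⟨x', y'⟩, hx⟩, ⟨⟨z, t⟩, ⟨z', t'⟩, ht⟩⟩ := hcon
  have : Nonempty (J₁ × J₂) := ⟨(x, t)⟩
  replace hx : a₁ ⬝ᵥ u (x, t) ≠ a₁ ⬝ᵥ u (x', t) := by rwa [h₁ x t y, h₁ x' t y']
  replace ht : a₂ ⬝ᵥ u (x, t) ≠ a₂ ⬝ᵥ u (x, t') := by rwa [h₂ x z t, h₂ x z' t']
  rcases h with ⟨hle, -, -, hfin⟩ | ⟨β', -, hβ⟩
  · have hsub : ∀ j, u j ∈ P := fun j => hP ▸ subset_convexHull ℝ _ ⟨j, rfl⟩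
    -- The mixed vertex `(j₁.1, j₂.2)` attains both maxima at once, so `β` is at least their sum and
    -- equality on the face forces both functionals to be maximal there.
    obtain ⟨j₁, hj₁⟩ := Finite.exists_max fun j => a₁ ⬝ᵥ u j
    obtain ⟨j₂, hj₂⟩ := Finite.exists_max fun j => a₂ ⬝ᵥ u j
    have hβ : a₁ ⬝ᵥ u j₁ + a₂ ⬝ᵥ u j₂ ≤ β := by
      have := hle _ (hsub (j₁.1, j₂.2))
      rwa [add_dotProduct, h₁ j₁.1 j₂.2 j₁.2, h₂ j₁.1 j₂.1 j₂.2] at this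
    have hF : ∀ z ∈ {x | x ∈ P ∧ (a₁ + a₂) ⬝ᵥ x = β},
        a₁ ⬝ᵥ z = a₁ ⬝ᵥ u j₁ ∧ a₂ ⬝ᵥ z = a₂ ⬝ᵥ u j₂ := by
      rintro z ⟨hz, hzβ⟩
      rw [hP] at hz
      have k₁ := dotProduct_le_of_mem_convexHull hj₁ hz
      have k₂ := dotProduct_le_of_mem_convexHull hj₂ hz
      rw [add_dotProduct] at hzβ
      constructor <;> linarith
    set F := {x | x ∈ P ∧ (a₁ + a₂) ⬝ᵥ x = β} with hFdef
    set L₁ : Submodule ℝ (D → ℝ) := LinearMap.ker (dotProductBilin ℝ ℝ a₁)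
    set L₂ : Submodule ℝ (D → ℝ) := LinearMap.ker (dotProductBilin ℝ ℝ a₂)
    have m₁ : ∀ w, w ∈ L₁ ↔ a₁ ⬝ᵥ w = 0 := fun w => Iff.rfl
    have m₂ : ∀ w, w ∈ L₂ ↔ a₂ ⬝ᵥ w = 0 := fun w => Iff.rfl
    -- Both functionals vanish on the directions of `F`. Each kernel cuts the dimension strictly,
    -- the second because moving only the second index stays in `L₁` but leaves `L₂`; this is one
    -- dimension too many for a facet.
    have hFle : vectorSpan ℝ F ≤ vectorSpan ℝ P ⊓ L₁ ⊓ L₂ := by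
      refine le_inf (le_inf (vectorSpan_mono ℝ fun z hz => hz.1) ?_) ?_ <;>
        refine Submodule.span_le.2 ?_ <;> rintro _ ⟨p, hp, q, hq, rfl⟩
      · simp [m₁, dotProduct_sub, (hF p hp).1, (hF q hq).1]
      · simp [m₂, dotProduct_sub, (hF p hp).2, (hF q hq).2]
    have lt₁ : vectorSpan ℝ P ⊓ L₁ < vectorSpan ℝ P := by
      refine lt_of_le_of_ne inf_le_left fun heq => ?_
      have hw := vsub_mem_vectorSpan ℝ (hsub (x, t)) (hsub (x', t))
      rw [← heq] at hw
      have := (m₁ _).1 hw.2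
      rw [vsub_eq_sub, dotProduct_sub, sub_eq_zero] at this
      exact hx this
    have lt₂ : vectorSpan ℝ P ⊓ L₁ ⊓ L₂ < vectorSpan ℝ P ⊓ L₁ := by
      refine lt_of_le_of_ne inf_le_left fun heq => ?_
      have hw : u (x, t) -ᵥ u (x, t') ∈ vectorSpan ℝ P ⊓ L₁ := by
        refine ⟨vsub_mem_vectorSpan ℝ (hsub (x, t)) (hsub (x, t')), (m₁ _).2 ?_⟩
        rw [vsub_eq_sub, dotProduct_sub, sub_eq_zero]
        exact h₁ _ _ _
      rw [← heq] at hw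
      have := (m₂ _).1 hw.2
      rw [vsub_eq_sub, dotProduct_sub, sub_eq_zero] at this
      exact ht this
    have := Submodule.finrank_mono hFle
    have := Submodule.finrank_lt_finrank_of_lt lt₁
    have := Submodule.finrank_lt_finrank_of_lt lt₂
    omega
  -- In the 2-level case the four vertices of the grid `{x, x'} × {t, t'}` suffice.
  · have hv : ∀ j, a₁ ⬝ᵥ u j + a₂ ⬝ᵥ u j = β ∨ a₁ ⬝ᵥ u j + a₂ ⬝ᵥ u j = β' := by
      intro j
      rw [← add_dotProduct]
      exact hβ _ (hext ▸ ⟨j, rfl⟩)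
    have k₁ := hv (x, t)
    have k₂ := hv (x, t')
    have k₃ := hv (x', t)
    have k₄ := hv (x', t')
    rw [h₁ x t' t] at k₂
    rw [h₂ x' x t] at k₃
    rw [h₁ x' t' t, h₂ x' x t'] at k₄
    exact (eq_or_eq_of_add_two_values k₁ k₂ k₃ k₄).elim hx ht

/-! ### Recognising a 1-product -/

/-- Each class of rows ignores one factor of the column index, so its block is read off by freezing
that index at an arbitrary `y₀` or `x₀`. -/
lemma Matrix.isOneProduct_of_equiv {I J J₁ J₂ : Type*} [Finite I] [Finite J₁] [Finite J₂]
    [Nonempty J₁] [Nonempty J₂] {S : Matrix I J ℝ} (f : J ≃ J₁ × J₂) (p : I → Prop)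
    (hp : ∃ i, p i) (hnp : ∃ i, ¬ p i)
    (h₁ : ∀ i, p i → ∀ x y y', S i (f.symm (x, y)) = S i (f.symm (x, y')))
    (h₂ : ∀ i, ¬ p i → ∀ x x' y, S i (f.symm (x, y)) = S i (f.symm (x', y))) :
    S.IsOneProduct := by
  classical
  obtain ⟨x₀⟩ := ‹Nonempty J₁›
  obtain ⟨y₀⟩ := ‹Nonempty J₂›
  let eI₁ := Finite.equivFin {i // p i}
  let eI₂ := Finite.equivFin {i // ¬ p i}
  let eJ₁ := Finite.equivFin J₁
  let eJ₂ := Finite.equivFin J₂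
  have : Nonempty {i // p i} := hp.elim fun i hi => ⟨⟨i, hi⟩⟩
  have : Nonempty {i // ¬ p i} := hnp.elim fun i hi => ⟨⟨i, hi⟩⟩
  have : Nonempty J₁ := ⟨x₀⟩
  have : Nonempty J₂ := ⟨y₀⟩
  refine ⟨_, _, _, _, Matrix.of fun i x => S (eI₁.symm i) (f.symm (eJ₁.symm x, y₀)),
    Matrix.of fun i y => S (eI₂.symm i) (f.symm (x₀, eJ₂.symm y)),
    Nat.card_pos, Nat.card_pos, Nat.card_pos, Nat.card_pos,
    (Equiv.sumCompl p).symm.trans (eI₁.sumCongr eI₂), f.trans (eJ₁.prodCongr eJ₂), ?_⟩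
  intro i j
  obtain ⟨⟨x, y⟩, rfl⟩ := f.symm.surjective j
  by_cases hi : p i
  · simpa [Matrix.oneProd, Equiv.sumCompl_symm_apply_of_pos hi] using h₁ i hi x y y₀
  · simpa [Matrix.oneProd, Equiv.sumCompl_symm_apply_of_neg hi] using h₂ i hi x x₀ y

/-! ### From a 1-product to a direct sum -/

section SlackMatrix

variable {α : Type*} {M : Matroid α} [Fintype M.E] {I J : Type*} {A : Matrix I M.E ℝ} {b : I → ℝ}
  {v : J → M.E → ℝ}

/-- If the slack matrix of a base polytope is a 1-product, then the matroid is a direct sum. -/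
lemma not_isConnectedMatroid_of_isOneProduct (hv : IsVertexList M.basePolytope v)
    (hA : IsInequalityDescription M.basePolytope A b)
    (hconst : ∀ i, ¬ ∃ c, ∀ j, slackMatrix A b v i j = c)
    (hS : (slackMatrix A b v).IsOneProduct) : ¬ M.IsConnectedMatroid := by
  obtain ⟨m₁, n₁, m₂, n₂, S₁, S₂, hm₁, hn₁, hm₂, hn₂, e, f, hef⟩ := hS
  obtain ⟨-, hinj, hrange⟩ := hv
  rw [Matroid.extremePoints_basePolytope] at hrange
  have hB : ∀ j, ∃ B, M.IsBase B ∧ v j = M.charVec B := fun j => by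
    have : v j ∈ Set.range v := ⟨j, rfl⟩
    rwa [hrange] at this
  have hsurj : ∀ B, M.IsBase B → ∃ j, v j = M.charVec B := fun B hB => by
    have : M.charVec B ∈ Set.range v := by rw [hrange]; exact ⟨B, hB, rfl⟩
    exact this
  have hmem : ∀ j, v j ∈ M.basePolytope := fun j => by
    obtain ⟨B, hB, h⟩ := hB j
    exact h ▸ Matroid.charVec_mem_basePolytope hB
  set u : Fin n₁ × Fin n₂ → M.E → ℝ := fun z => v (f.symm z) with hu
  have hrow : ∀ i z, (A *ᵥ u z) i =
      b i - Sum.elim (fun i₁ => S₁ i₁ z.1) (fun i₂ => S₂ i₂ z.2) (e i) := by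
    intro i z
    have := hef i (f.symm z)
    simp only [slackMatrix, Matrix.oneProd, Matrix.of_apply, Equiv.apply_symm_apply] at this
    rw [← this]
    simp [hu]
  -- A row from `S₁` does not see `y` and a row from `S₂` does not see `x`, so `A` kills this
  -- alternating sum, which is a direction of the polytope.
  have hpar : ∀ x x' y y', u (x, y) - u (x', y) = u (x, y') - u (x', y') := by
    intro x x' y y'
    rw [← sub_eq_zero]
    refine hA.eq_zero_of_mulVec_eq_zero Matroid.basePolytope_subset_Icc ⟨_, hmem (f.symm (x, y))⟩
      (Submodule.sub_mem _ (vsub_mem_vectorSpan ℝ (hmem _) (hmem _))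
        (vsub_mem_vectorSpan ℝ (hmem _) (hmem _))) ?_
    funext i
    simp only [Matrix.mulVec_sub, Pi.sub_apply, hrow, Pi.zero_apply]
    rcases e i with i₁ | i₂ <;> simp
  have h01 : ∀ z d, u z d = 0 ∨ u z d = 1 := by
    intro z d
    obtain ⟨B, -, h⟩ := hB (f.symm z)
    simp only [hu, h]
    exact Matroid.charVec_eq_zero_or_one B d
  have hcoord : ∀ d, (∀ x y y', u (x, y) d = u (x, y') d) ∨
      (∀ x x' y, u (x, y) d = u (x', y) d) := by
    intro d
    by_contra! hcon
    obtain ⟨⟨x, y, y', h⟩, z, z', t, h'⟩ := hcon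
    have hp : ∀ x x' y y', u (x, y) d - u (x', y) d = u (x, y') d - u (x', y') d :=
      fun x x' y y' => congrFun (hpar x x' y y') d
    have c : ∀ x' y', u (x', y') d = u (x', y) d + (u (x, y') d - u (x, y) d) := fun x' y' => by
      have := hp x x' y y'
      linarith
    -- By `c`, the four sums `s + p`, `s + q`, `t + p`, `t + q` are coordinates of vertices, hence 0
    -- or 1.
    have k := eq_or_eq_of_add_two_values (s := u (z, y) d) (t := u (z', y) d) (p := 0)
      (q := u (x, y') d - u (x, y) d) (β := 0) (β' := 1)
      (by simpa using h01 (z, y)  d) (by simpa [← c] using h01 (z, y') d)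
      (by simpa using h01 (z', y) d) (by simpa [← c] using h01 (z', y') d)
    rcases k with k | k
    · refine h' ?_
      rw [c z t, c z' t, k]
    · exact h (by linarith)
  set E₁ : Set α := {a | ∃ h : a ∈ M.E, ∀ x y y', u (x, y) ⟨a, h⟩ = u (x, y') ⟨a, h⟩} with hE₁
  have hE₁M : E₁ ⊆ M.E := fun a h => h.1
  have hunion : E₁ ∪ M.E \ E₁ = M.E := Set.union_sdiff_cancel hE₁M
  have hE₂ : ∀ d : M.E, (d : α) ∉ E₁ → ∀ x x' y, u (x, y) d = u (x', y) d :=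
    fun d hd => (hcoord d).resolve_left fun h => hd ⟨d.2, h⟩
  refine fun hc => hc ⟨M.restrict E₁, M.restrict (M.E \ E₁), Set.disjoint_sdiff_right, ?_, ?_,
    Matroid.eq_disjointSum_of_isBase_union _ hunion ?_⟩
  -- If `E₁` were empty, vertices would not depend on the first index. As they are distinct, that
  -- index takes a single value, and a row of `S₁` becomes a constant row of the slack matrix.
  · by_contra hempty
    have hE : ∀ d : M.E, (d : α) ∉ E₁ := fun d hd => hempty ⟨d, hd⟩
    refine hconst (e.symm (Sum.inl ⟨0, hm₁⟩)) ⟨S₁ ⟨0, hm₁⟩ ⟨0, hn₁⟩, fun j => ?_⟩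
    have : u ((f j).1, (f j).2) = u (⟨0, hn₁⟩, (f j).2) :=
      funext fun d => hE₂ d (hE d) _ _ _
    have := congrArg Prod.fst (f.symm.injective (hinj this))
    rw [hef]
    simp only [Equiv.apply_symm_apply, Matrix.oneProd, Matrix.of_apply, Sum.elim_inl]
    rw [show (f j).1 = ⟨0, hn₁⟩ from this]
  · by_contra hempty
    have hE : ∀ d : M.E, (d : α) ∈ E₁ := fun d => by
      by_contra hd
      exact hempty ⟨d, d.2, hd⟩
    refine hconst (e.symm (Sum.inr ⟨0, hm₂⟩)) ⟨S₂ ⟨0, hm₂⟩ ⟨0, hn₂⟩, fun j => ?_⟩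
    have : u ((f j).1, (f j).2) = u ((f j).1, ⟨0, hn₂⟩) :=
      funext fun d => (hE d).2 _ _ _
    have := congrArg Prod.snd (f.symm.injective (hinj this))
    rw [hef]
    simp only [Equiv.apply_symm_apply, Matrix.oneProd, Matrix.of_apply, Sum.elim_inr]
    rw [show (f j).2 = ⟨0, hn₂⟩ from this]
  · intro B B' hBb hBb'
    obtain ⟨j, hj⟩ := hsurj B hBb
    obtain ⟨j', hj'⟩ := hsurj B' hBb'
    -- The recombined base is that of the vertex with the first index of `B` and the second of `B'`.
    obtain ⟨C, hC, hCu⟩ := hB (f.symm ((f j).1, (f j').2))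
    convert hC using 1
    have hju : u ((f j).1, (f j).2) = M.charVec B := by simp [hu, hj]
    have hju' : u ((f j').1, (f j').2) = M.charVec B' := by simp [hu, hj']
    have hCu' : u ((f j).1, (f j').2) = M.charVec C := hCu
    ext a
    by_cases ha : a ∈ M.E
    · by_cases ha₁ : a ∈ E₁
      · have := ha₁.2 (f j).1 (f j).2 (f j').2
        rw [hju, hCu', Matroid.charVec_eq_iff] at this
        simpa [ha₁] using this
      · have := hE₂ ⟨a, ha⟩ ha₁ (f j').1 (f j).1 (f j').2
        rw [hju', hCu', Matroid.charVec_eq_iff] at this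
        simpa [ha₁, ha] using this
    · refine iff_of_false ?_ fun h => ha (hC.subset_ground h)
      rintro (h | h)
      · exact ha (hE₁M h.2)
      · exact ha h.2.1

end SlackMatrix

/-! ### From a direct sum to a 1-product -/

/-- An element that is neither a loop nor a coloop lies in some base and is missed by another; their
traces on the summand differ. This supplies two vertices that differ in one factor only. -/
lemma Matroid.nontrivial_isBase_of_disjointSum {α : Type*} {M₁ M₂ : Matroid α}
    {h : Disjoint M₁.E M₂.E} (hne : M₁.E.Nonempty)
    (hloop : ∀ e, ¬ (M₁.disjointSum M₂ h).IsLoop e)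
    (hcoloop : ∀ e, ¬ (M₁.disjointSum M₂ h).IsColoop e) :
    ∃ B B', M₁.IsBase B ∧ M₁.IsBase B' ∧ B ≠ B' := by
  obtain ⟨e, he⟩ := hne
  have heE : e ∈ (M₁.disjointSum M₂ h).E := by simp [he]
  have h1 : ∃ B, (M₁.disjointSum M₂ h).IsBase B ∧ e ∈ B := by
    obtain ⟨B, hB, heB⟩ := ((not_isLoop_iff heE).1 (hloop e)).exists_mem_isBase
    exact ⟨B, hB, heB⟩
  have h2 : ∃ B, (M₁.disjointSum M₂ h).IsBase B ∧ e ∉ B := by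
    by_contra! hcon
    exact hcoloop e (isColoop_iff_forall_mem_isBase.2 fun B hB => hcon B hB)
  obtain ⟨B, hB, heB⟩ := h1
  obtain ⟨B', hB', heB'⟩ := h2
  refine ⟨B ∩ M₁.E, B' ∩ M₁.E, (disjointSum_isBase_iff.1 hB).1, (disjointSum_isBase_iff.1 hB').1,
    fun heq => heB' ?_⟩
  have : e ∈ B ∩ M₁.E := ⟨heB, he⟩
  rw [heq] at this
  exact this.1

/-- The slack matrix of the base polytope of a direct sum is a 1-product. -/
lemma isOneProduct_slackMatrix_disjointSum {α : Type*} {M M₁ M₂ : Matroid α}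
    {h : Disjoint M₁.E M₂.E} (hM : M = M₁.disjointSum M₂ h) [Fintype M.E]
    (hne₁ : M₁.E.Nonempty) (hne₂ : M₂.E.Nonempty)
    (hloop : ∀ e, ¬ M.IsLoop e)
    (hcoloop : ∀ e, ¬ M.IsColoop e)
    {I J : Type*} [Finite I] [Finite J] {A : Matrix I M.E ℝ} {b : I → ℝ}
    {v : J → M.E → ℝ}
    (hv : IsVertexList M.basePolytope v)
    (hA : IsInequalityDescription M.basePolytope A b)
    (hrow : ∀ i, IsFacetDefining M.basePolytope (A i) (b i) ∨
      IsTwoLevel M.basePolytope (A i) (b i)) :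
    (slackMatrix A b v).IsOneProduct := by
  classical
  obtain ⟨X, X', hX, hX', hXX'⟩ := Matroid.nontrivial_isBase_of_disjointSum (h := h) hne₁
    (hM ▸ hloop) (hM ▸ hcoloop)
  obtain ⟨Y, Y', hY, hY', hYY'⟩ := Matroid.nontrivial_isBase_of_disjointSum (h := h.symm) hne₂
    (by rwa [← Matroid.disjointSum_comm (h := h), ← hM])
    (by rwa [← Matroid.disjointSum_comm (h := h), ← hM])
  have hME : M.E = M₁.E ∪ M₂.E := by rw [hM, Matroid.disjointSum_ground_eq]
  have hbase : ∀ C, M.IsBase C ↔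
      M₁.IsBase (C ∩ M₁.E) ∧ M₂.IsBase (C ∩ M₂.E) ∧ C ⊆ M₁.E ∪ M₂.E := by
    intro C
    rw [hM, Matroid.disjointSum_isBase_iff]
  obtain ⟨hhull, hinj, hrange⟩ := hv
  have hrange' := hrange
  rw [Matroid.extremePoints_basePolytope] at hrange'
  have hB : ∀ j, ∃ B, M.IsBase B ∧ v j = M.charVec B := fun j => by
    have : v j ∈ Set.range v := ⟨j, rfl⟩
    rwa [hrange'] at this
  choose B hBb hBv using hB
  have hsurj : ∀ C, M.IsBase C → ∃ j, v j = M.charVec C := fun C hC => by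
    have : M.charVec C ∈ Set.range v := by rw [hrange']; exact ⟨C, hC, rfl⟩
    exact this
  have hmem : ∀ j, v j ∈ M.basePolytope := fun j => by
    rw [hBv]
    exact Matroid.charVec_mem_basePolytope (hBb j)
  let f₀ : J → {C // M₁.IsBase C} × {C // M₂.IsBase C} := fun j =>
    (⟨B j ∩ M₁.E, ((hbase _).1 (hBb j)).1⟩,
      ⟨B j ∩ M₂.E, ((hbase _).1 (hBb j)).2.1⟩)
  have hf₀ : Function.Bijective f₀ := by
    constructor
    · intro j j' hjj'
      have e₁ : B j ∩ M₁.E = B j' ∩ M₁.E := congrArg (fun z => z.1.1) hjj'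
      have e₂ : B j ∩ M₂.E = B j' ∩ M₂.E := congrArg (fun z => z.2.1) hjj'
      refine hinj ?_
      have k : ∀ j, B j = B j ∩ M₁.E ∪ B j ∩ M₂.E := fun j => by
        rw [← Set.inter_union_distrib_left, ← hME, Set.inter_eq_left.2 (hBb j).subset_ground]
      rw [hBv, hBv, k j, k j', e₁, e₂]
    · rintro ⟨⟨C₁, h₁⟩, ⟨C₂, h₂⟩⟩
      have i₁ : (C₁ ∪ C₂) ∩ M₁.E = C₁ := by
        rw [Set.union_inter_distrib_right, Set.inter_eq_left.2 h₁.subset_ground,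
          (h.symm.mono_left h₂.subset_ground).inter_eq, Set.union_empty]
      have i₂ : (C₁ ∪ C₂) ∩ M₂.E = C₂ := by
        rw [Set.union_inter_distrib_right, Set.inter_eq_left.2 h₂.subset_ground,
          (h.mono_left h₁.subset_ground).inter_eq, Set.empty_union]
      have hC : M.IsBase (C₁ ∪ C₂) := (hbase _).2
        ⟨by rwa [i₁], by rwa [i₂], Set.union_subset_union h₁.subset_ground h₂.subset_ground⟩
      obtain ⟨j, hj⟩ := hsurj _ hC
      have hBj : B j = C₁ ∪ C₂ :=
        Matroid.charVec_injOn (hBb j).subset_ground hC.subset_ground ((hBv j).symm.trans hj)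
      refine ⟨j, ?_⟩
      simp only [f₀, hBj, i₁, i₂]
  let f := Equiv.ofBijective f₀ hf₀
  have : Finite ({C // M₁.IsBase C} × {C // M₂.IsBase C}) := Finite.of_equiv J f
  have : Nonempty {C // M₁.IsBase C} := ⟨⟨X, hX⟩⟩
  have : Nonempty {C // M₂.IsBase C} := ⟨⟨Y, hY⟩⟩
  have : Finite {C // M₁.IsBase C} := Finite.prod_left {C // M₂.IsBase C}
  have : Finite {C // M₂.IsBase C} := Finite.prod_right {C // M₁.IsBase C}
  set u : {C // M₁.IsBase C} × {C // M₂.IsBase C} → M.E → ℝ := fun z => v (f.symm z) with hu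
  have hu₁ : ∀ z (d : M.E), (d : α) ∈ M₁.E → u z d = M.charVec z.1.1 d := by
    intro z d hd
    have : z.1.1 = B (f.symm z) ∩ M₁.E := congrArg (fun z => z.1.1) (f.apply_symm_apply z).symm
    rw [this, hu]
    simp only [hBv]
    rw [Matroid.charVec_eq_iff]
    simp [hd]
  have hu₂ : ∀ z (d : M.E), (d : α) ∉ M₁.E → u z d = M.charVec z.2.1 d := by
    intro z d hd
    have hd' : (d : α) ∈ M₂.E := by
      have : (d : α) ∈ M₁.E ∪ M₂.E := hME ▸ d.2
      exact this.resolve_left hd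
    have : z.2.1 = B (f.symm z) ∩ M₂.E := congrArg (fun z => z.2.1) (f.apply_symm_apply z).symm
    rw [this, hu]
    simp only [hBv]
    rw [Matroid.charVec_eq_iff]
    simp [hd']
  have hinju : Function.Injective u := hinj.comp f.symm.injective
  have hrangeu : Set.range u = Set.range v := f.symm.surjective.range_comp v
  -- Split each row by support, so that `a₁` sees only the base of `M₁` and `a₂` only that of `M₂`.
  let a₁ : I → M.E → ℝ := fun i d => if (d : α) ∈ M₁.E then A i d else 0
  let a₂ : I → M.E → ℝ := fun i d => if (d : α) ∈ M₁.E then 0 else A i d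
  have ha : ∀ i, a₁ i + a₂ i = A i := by
    intro i
    funext d
    by_cases hd : (d : α) ∈ M₁.E <;> simp [a₁, a₂, hd]
  have h₁ : ∀ i x y y', a₁ i ⬝ᵥ u (x, y) = a₁ i ⬝ᵥ u (x, y') := by
    intro i x y y'
    refine Finset.sum_congr rfl fun d _ => ?_
    by_cases hd : (d : α) ∈ M₁.E <;> simp [a₁, hd, hu₁]
  have h₂ : ∀ i x x' y, a₂ i ⬝ᵥ u (x, y) = a₂ i ⬝ᵥ u (x', y) := by
    intro i x x' y
    refine Finset.sum_congr rfl fun d _ => ?_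
    by_cases hd : (d : α) ∈ M₁.E <;> simp [a₂, hd, hu₂]
  have hAu : ∀ i z, (A *ᵥ u z) i = a₁ i ⬝ᵥ u z + a₂ i ⬝ᵥ u z := by
    intro i z
    rw [← add_dotProduct, ha]
    rfl
  have hS : ∀ i z, slackMatrix A b v i (f.symm z) = b i - (a₁ i ⬝ᵥ u z + a₂ i ⬝ᵥ u z) := by
    intro i z
    rw [← hAu]
    rfl
  have hsplit : ∀ i, (∀ z z', a₁ i ⬝ᵥ u z = a₁ i ⬝ᵥ u z') ∨
      (∀ z z', a₂ i ⬝ᵥ u z = a₂ i ⬝ᵥ u z') := by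
    intro i
    refine const_of_isFacetDefining_or_isTwoLevel (hrangeu ▸ hhull) (hrangeu.trans hrange)
      (h₁ i) (h₂ i) (β := b i) ?_
    rw [ha]
    exact hrow i
  have hne : ∀ z z', A *ᵥ u z = A *ᵥ u z' → z = z' := by
    intro z z' hzz'
    refine hinju (sub_eq_zero.1 ?_)
    refine hA.eq_zero_of_mulVec_eq_zero Matroid.basePolytope_subset_Icc ⟨_, hmem (f.symm z)⟩
      (vsub_mem_vectorSpan ℝ (hmem _) (hmem _)) ?_
    rw [Matrix.mulVec_sub, hzz', sub_self]
  -- Rows with constant `a₂` form the first block; by `hsplit` the others have constant `a₁`.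
  refine Matrix.isOneProduct_of_equiv f (fun i => ∀ z z', a₂ i ⬝ᵥ u z = a₂ i ⬝ᵥ u z')
    ?_ ?_ ?_ ?_
  -- If the first block were empty, no row would separate the vertices `(X, Y)` and `(X', Y)`,
  -- contradicting `hne`. The second block is treated likewise with `Y` and `Y'`.
  · by_contra! hcon
    refine hXX' (congrArg (fun z => z.1.1)
      (hne (⟨X, hX⟩, ⟨Y, hY⟩) (⟨X', hX'⟩, ⟨Y, hY⟩) (funext fun i => ?_)))
    rw [hAu, hAu, h₂ i _ ⟨X', hX'⟩]
    have := (hsplit i).resolve_right fun hc => by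
      obtain ⟨z, z', hz⟩ := hcon i
      exact hz (hc z z')
    rw [this]
  · by_contra! hcon
    refine hYY' (congrArg (fun z => z.2.1)
      (hne (⟨X, hX⟩, ⟨Y, hY⟩) (⟨X, hX⟩, ⟨Y', hY'⟩) (funext fun i => ?_)))
    rw [hAu, hAu, h₁ i _ _ ⟨Y', hY'⟩, hcon i (⟨X, hX⟩, ⟨Y, hY⟩)]
  · intro i hi x y y'
    rw [hS, hS, h₁ i x y y', hi (x, y)]
  · intro i hi x x' y
    rw [hS, hS, h₂ i x x' y, ((hsplit i).resolve_right hi) (x, y)]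

theorem mainTheorem11 {α : Type*} (M : Matroid α) [Fintype M.E]
    (hloop : ∀ e, ¬ M.IsLoop e) (hcoloop : ∀ e, ¬ M.IsColoop e)
    {m n : ℕ} (A : Matrix (Fin m) M.E ℝ) (b : Fin m → ℝ) (v : Fin n → M.E → ℝ)
    (hv : IsVertexList M.basePolytope v)
    (hA : IsInequalityDescription M.basePolytope A b)
    (hconst : ∀ i, ¬ ∃ c, ∀ j, slackMatrix A b v i j = c)
    (hrow : ∀ i, IsFacetDefining M.basePolytope (A i) (b i) ∨
      IsTwoLevel M.basePolytope (A i) (b i)) :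
    M.IsConnectedMatroid ↔ (slackMatrix A b v).OneProdIrreducible := by
  constructor
  · exact fun hM hS => not_isConnectedMatroid_of_isOneProduct hv hA hconst hS hM
  · rintro hS ⟨M₁, M₂, h, hne₁, hne₂, hM⟩
    exact hS (isOneProduct_slackMatrix_disjointSum hM hne₁ hne₂ hloop hcoloop hv hA hrow)
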